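/- There is an absolute constant $c>0$ such that for all integers $k\ge 2$ and $n\ge 0$ $$R_{1/4}(\mathrm{DISJ}_{k,n})\;\ge\; c\cdot\frac{n^{1/(k+1)}}{2^{2^k}} .$$ Here $-1$ stands for "true" and $+1$ for "false"; $\mathrm{OR}_n(z)=-1$ if $z_j=-1$ for some $j$, and $\mathrm{OR}_n(z)=+1$ otherwise; $x_1\wedge\dots\wedge x_k$ is the string whose $j$-th entry is $-1$ if every $x_i$ has a $-1$ in position $j$, and $+1$ otherwise; and $$\mathrm{DISJ}_{k,n}:(\{-1,+1\}^n)^k\to\{-1,+1\},\qquad \mathrm{DISJ}_{k,n}(x_1,\dots,x_k)=-\mathrm{OR}_n(x_1\wedge\dots\wedge x_k).$$ A deterministic $k$-party number-on-the-forehead protocol on $X_1\times\dots\times X_k$ is a finite binary tree whose leaves are labelled by outputs in $\{-1,+1\}$ and each of whose inner nodes is labelled by a player $i$ and a $\{0,1\}$-valued function of the inputs $(x_j)_{j\ne i}$, whose value is the bit that player $i$ announces and determines the child at which the protocol continues; its cost is the depth of the tree. A public-coin randomized protocol is a probability distribution over deterministic protocols; its cost is the largest cost of a protocol in its support. $R_\epsilon(f)$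 is the least cost of a public-coin randomized protocol that, on every input $x$, outputs a value different from $f(x)$ with probability at most $\epsilon$. -/

import Mathlib

/-! Throughout, `{-1, +1}` is the type `ℤˣ`, and `-1` is interpreted as "true". -/

/-- The `OR` function on `n` bits. -/
def orFn (n : ℕ) (z : Fin n → ℤˣ) : ℤˣ :=
  if ∃ j, z j = -1 then -1 else 1

/-- The bitwise conjunction `x₁ ∧ ⋯ ∧ x_k` of `k` strings of length `n`. -/
def andStrings (k n : ℕ) (x : Fin k → Fin n → ℤˣ) : Fin n → ℤˣ :=
  fun j => if ∀ i, x i j = -1 then -1 else 1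

/-- `DISJ_{k,n}(x₁, …, x_k) = -OR_n(x₁ ∧ ⋯ ∧ x_k)`. -/
def disjFn (k n : ℕ) (x : Fin k → Fin n → ℤˣ) : ℤˣ :=
  -orFn n (andStrings k n x)

/-- Deterministic `k`-party number-on-the-forehead protocols (blackboard protocol trees) on
`X₁ × ⋯ × X_k` with outputs in `{-1, +1}`. At an inner node, player `i` writes one bit, which
depends on all inputs except the `i`-th one (and, through the node, on the bits written so far). -/
inductive NOFProtocol {k : ℕ} (X : Fin k → Type) : Type
  | output (b : ℤˣ) : NOFProtocol X
  | speak (i : Fin k) (msg : ((j : {j : Fin k // j ≠ i}) → X j.1) → Bool)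
      (next : Bool → NOFProtocol X) : NOFProtocol X

namespace NOFProtocol

variable {k : ℕ} {X : Fin k → Type}

/-- The output of a protocol on a given input. -/
def eval : NOFProtocol X → ((i : Fin k) → X i) → ℤˣ
  | output b, _ => b
  | speak _ msg next, x => (next (msg fun j => x j.1)).eval x

/-- The cost of a protocol: the maximal number of bits written (the depth of the tree). -/
def cost : NOFProtocol X → ℕ
  | output _ => 0
  | speak _ _ next => max (next false).cost (next true).cost + 1

end NOFProtocol

/-- `f` has a public-coin randomized number-on-the-forehead protocol, i.e. a probability
distribution over deterministic protocols, in which every protocol that occurs has cost at most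
`c`, and which errs with probability at most `ε` on every input. -/
def HasRandProtocol {k : ℕ} {X : Fin k → Type} (ε : ℝ) (f : ((i : Fin k) → X i) → ℤˣ) (c : ℕ) :
    Prop :=
  ∃ P : PMF (NOFProtocol X),
    (∀ p ∈ P.support, p.cost ≤ c) ∧
    ∀ x, P.toOuterMeasure {p | p.eval x ≠ f x} ≤ ENNReal.ofReal ε

/-- The public-coin randomized `k`-party number-on-the-forehead communication complexity
`R_ε(f)`: the least cost of a randomized protocol for `f` with error at most `ε`. (The infimum is
over a nonempty set for `k ≥ 2` and finite `X i`, see `exists_hasRandProtocol`.) -/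
noncomputable def randCC {k : ℕ} {X : Fin k → Type} (ε : ℝ) (f : ((i : Fin k) → X i) → ℤˣ) : ℕ :=
  sInf {c : ℕ | HasRandProtocol ε f c}

/-- For at least two players and finite input sets, every function has a protocol. -/
theorem exists_hasRandProtocol {k : ℕ} (hk : 2 ≤ k) {X : Fin k → Type} [∀ i, Finite (X i)] (ε : ℝ)
    (f : ((i : Fin k) → X i) → ℤˣ) : ∃ c, HasRandProtocol ε f c := by
  classical
  let a : Fin k := ⟨0, by omega⟩
  let b : Fin k := ⟨1, by omega⟩
  have hab : b ≠ a := by simp [a, b]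
  have key : ∀ l : List (X b), ∃ p : NOFProtocol X, ∀ x, x b ∈ l → p.eval x = f x := by
    intro l
    induction l with
    | nil => exact ⟨.output 1, by simp⟩
    | cons v l ih =>
      obtain ⟨p, hp⟩ := ih
      refine ⟨.speak a (fun y => decide (y ⟨b, hab⟩ = v)) (fun t => if t = true then
        .speak b (fun y => decide (f (fun j => if h : j = b then h ▸ v else y ⟨j, h⟩) = 1))
          (fun s => .output (if s = true then 1 else -1)) else p), ?_⟩
      intro x hx
      by_cases hv : x b = v
      · have hfx : (fun j => if h : j = b then h ▸ v else x j) = x := by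
          funext j
          by_cases h : j = b
          · subst h; simp [hv]
          · simp [h]
        rcases Int.units_eq_one_or (f x) with h1 | h1 <;>
          simp [NOFProtocol.eval, hv, hfx, h1]
      · have : x b ∈ l := by simpa [hv] using hx
        simp [NOFProtocol.eval, hv, hp x this]
  have := Fintype.ofFinite (X b)
  obtain ⟨p, hp⟩ := key Finset.univ.toList
  refine ⟨p.cost, PMF.pure p, by simp, fun x => ?_⟩
  rw [PMF.toOuterMeasure_pure_apply]
  simp [hp x (by simp)]

/-!
A randomized protocol for disjointness is refuted by a function `A` on inputs which correlates well
with `DISJ` but not with any cheap deterministic protocol. The function is obtained by lifting a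
dual witness for the approximate degree of `OR` (the pattern tensor method).

The dual witness `ψ : {-1, +1}^m → ℝ` of `exists_or_dual` has total mass at most `1`, correlation
`2 / 3` with `OR`, and is orthogonal to all functions of at most `N` coordinates, where
`m = 8 N ^ 2`. It is explicit: the Lagrange weights for the nodes `0, 1, 8·1², …, 8·N²` define a
signed measure on `{0, …, m}` that annihilates polynomials of degree at most `N` and has at least a
third of its mass at `0`. Spreading the mass at `t` over the strings with `t` entries `-1` gives
`ψ`.

For the lift, let player `0` hold a table `x` with `m` rows, each indexed by `(Fin ℓ)^K`, and let
player `i + 1` hold the `i`-th component of an address in every row. With the sets chosen as in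
`tableInput`, disjointness evaluates `-OR` on the cells that are read, and the lift of `ψ` is `ψ`
applied to these cells. To bound its correlation with a cylinder intersection
(`expect_readTable_pow_le`), the Cauchy-Schwarz inequality is applied once for each address
component (`expect_mul_prod_pow_le_box`). This replaces the correlation by an average, over two
independent choices of all the components, of the correlation of `2 ^ K` readings of the same table.
If the two choices coincide in some component on at most `N` rows only, then the correlation of the
readings vanishes by the orthogonality of `ψ` (`sum_prod_readTable_eq_zero`). Otherwise it is at
most exponential in the number of rows with a coincidence (`abs_expect_prod_readTable_le`).
Coincidences on more than `N` rows are so rare for `ℓ` of the order of `N` (with a constant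
depending on `K`) that the `2 ^ K`-th power of the correlation is at most `2 ^ (-N)`.

Since a protocol of cost `c` is a signed sum of `2 ^ c` cylinder intersections
(`abs_sum_mul_eval_le`), this gives `N ≤ 2 ^ K * (c + 3)`, while the universe has size
`m * ℓ ^ K`, of the order of `N ^ (K + 2)`.
-/

namespace DisjLowerBound

open Finset
open scoped BigOperators Polynomial Nat ENNReal

/-! ### A signed measure on the line that annihilates polynomials -/

lemma prod_abs_sub_range (i e : ℕ) :
    ∏ j ∈ range (i + 1 + e), (if j = i then (1 : ℝ) else |(i : ℝ) - j|) = i ! * e ! := by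
  rw [prod_range_add, prod_range_succ, if_pos rfl, mul_one]
  congr 1
  · rw [← prod_range_add_one_eq_factorial, ← prod_range_reflect]
    push_cast
    refine prod_congr rfl fun j hj => ?_
    have hj := mem_range.1 hj
    rw [if_neg (by omega)]
    have : i - 1 - j = i - (j + 1) := by omega
    rw [this, Nat.cast_sub (by omega)]
    push_cast
    rw [abs_of_nonneg]
    · ring
    · have : (j : ℝ) + 1 ≤ i := by exact_mod_cast hj
      linarith
  · rw [← prod_range_add_one_eq_factorial]
    push_cast
    refine prod_congr rfl fun j _ => ?_
    rw [if_neg (by omega), abs_sub_comm, abs_of_nonneg]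
    · ring
    · have : (0 : ℝ) ≤ j := by positivity
      linarith

lemma factorial_sq_le (e a : ℕ) : (a + e)! ^ 2 ≤ e ! * (a + (a + e))! := by
  have h1 := Nat.choose_mul_factorial_mul_factorial (n := 2 * (a + e)) (k := a + e) (by omega)
  have h2 := Nat.choose_mul_factorial_mul_factorial (n := 2 * (a + e)) (k := e) (by omega)
  have h3 : (2 * (a + e)).choose e ≤ (2 * (a + e)).choose (a + e) :=
    Nat.choose_le_centralBinom e (a + e)
  rw [show 2 * (a + e) - (a + e) = a + e by omega] at h1
  rw [show 2 * (a + e) - e = a + (a + e) by omega] at h2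
  have hpos : 0 < (2 * (a + e)).choose e := Nat.choose_pos (by omega)
  refine Nat.le_of_mul_le_mul_left ?_ hpos
  calc (2 * (a + e)).choose e * (a + e)! ^ 2 ≤ (2 * (a + e)).choose (a + e) * (a + e)! ^ 2 := by
        gcongr
    _ = (2 * (a + e)).choose e * (e ! * (a + (a + e))!) := by
        rw [sq, ← mul_assoc, h1, ← mul_assoc, h2]

/-- This says that the Lagrange weight of the node `8 * (i + 1) ^ 2` among the nodes
`8 * (j + 1) ^ 2` is at most twice what it would be if each factor
`8 * (i + 1) ^ 2 - 8 * (j + 1) ^ 2` were replaced by `8 * (j + 1) ^ 2`. After factoring the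
differences of squares it becomes the maximality of the central binomial coefficient. -/
lemma prod_scaled_sq_le (i N : ℕ) (h : i < N) :
    ∏ j ∈ range N, (8 * ((j : ℝ) + 1) ^ 2) ≤ 2 * (8 * ((i : ℝ) + 1) ^ 2) *
      ∏ j ∈ range N,
        (if j = i then (1 : ℝ) else |8 * ((i : ℝ) + 1) ^ 2 - 8 * ((j : ℝ) + 1) ^ 2|) := by
  obtain ⟨e, rfl⟩ : ∃ e, N = i + 1 + e := ⟨N - (i + 1), by omega⟩
  set F : ℕ → ℝ := fun j =>
    if j = i then (1 : ℝ) else |8 * ((i : ℝ) + 1) ^ 2 - 8 * ((j : ℝ) + 1) ^ 2|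
  have hFG : ∀ j, (if j = i then 16 * ((i : ℝ) + 1) else 1) * F j
      = 8 * (if j = i then (1 : ℝ) else |(i : ℝ) - j|) * ((i : ℝ) + 1 + j + 1) := by
    intro j
    by_cases hj : j = i
    · subst hj; simp [F]; ring
    · simp only [F, hj, if_false]
      have : 8 * ((i : ℝ) + 1) ^ 2 - 8 * ((j : ℝ) + 1) ^ 2
          = (8 * ((i : ℝ) + 1 + j + 1)) * ((i : ℝ) - j) := by ring
      rw [this, abs_mul, abs_of_nonneg (a := 8 * ((i : ℝ) + 1 + j + 1)) (by positivity)]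
      ring
  have hprod : 16 * ((i : ℝ) + 1) * ∏ j ∈ range (i + 1 + e), F j
      = 8 ^ (i + 1 + e) * (i ! * e !) * ∏ j ∈ range (i + 1 + e), ((i : ℝ) + 1 + j + 1) := by
    have := prod_congr (rfl : range (i + 1 + e) = _) fun j _ => hFG j
    rw [prod_mul_distrib, prod_mul_distrib, prod_mul_distrib, prod_abs_sub_range,
      prod_ite_eq' (range (i + 1 + e)) i] at this
    simpa only [mem_range, h, if_true, prod_const, card_range] using this
  have hasc : ((i + 1)! : ℝ) * ∏ j ∈ range (i + 1 + e), ((i : ℝ) + 1 + j + 1)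
      = (i + 1 + (i + 1 + e))! := by
    rw [← Nat.factorial_mul_ascFactorial (i + 1), Nat.ascFactorial_eq_prod_range]
    rw [Nat.cast_mul, Nat.cast_prod]
    congr 1
    refine prod_congr rfl fun j _ => ?_
    push_cast
    ring
  have hL : ∏ j ∈ range (i + 1 + e), (8 * ((j : ℝ) + 1) ^ 2)
      = 8 ^ (i + 1 + e) * ((i + 1 + e)! : ℝ) ^ 2 := by
    rw [prod_mul_distrib, prod_pow, ← prod_range_add_one_eq_factorial]
    simp only [prod_const, card_range]
    push_cast
    rfl
  have hR : 2 * (8 * ((i : ℝ) + 1) ^ 2) * ∏ j ∈ range (i + 1 + e), F j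
      = 8 ^ (i + 1 + e) * (e ! * (i + 1 + (i + 1 + e))! : ℝ) := by
    rw [← hasc, Nat.factorial_succ]
    push_cast
    linear_combination ((i : ℝ) + 1) * hprod
  rw [hL, hR]
  gcongr
  exact_mod_cast factorial_sq_le e (i + 1)

lemma sum_range_inv_sq_le (N : ℕ) : ∑ j ∈ range N, (((j : ℝ) + 1) ^ 2)⁻¹ ≤ 2 := by
  suffices h : ∑ j ∈ range N, (((j : ℝ) + 1) ^ 2)⁻¹ ≤ 2 - (N : ℝ)⁻¹ from
    h.trans (by have : 0 ≤ (N : ℝ)⁻¹ := by positivity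
                linarith)
  induction N with
  | zero => norm_num
  | succ n ih =>
    rw [sum_range_succ]
    rcases Nat.eq_zero_or_pos n with rfl | hn
    · norm_num
    have hn' : (0 : ℝ) < n := by exact_mod_cast hn
    have : (((n : ℝ) + 1) ^ 2)⁻¹ ≤ (n : ℝ)⁻¹ - ((n : ℝ) + 1)⁻¹ := by
      rw [inv_sub_inv (by positivity) (by positivity), inv_eq_one_div]
      rw [show (n : ℝ) + 1 - n = 1 by ring]
      gcongr
      nlinarith
    push_cast
    linarith

lemma one_sub_sum_le_prod_one_sub (N : ℕ) (x : ℕ → ℝ) (h0 : ∀ i, 0 ≤ x i) (h1 : ∀ i, x i ≤ 1) :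
    1 - ∑ i ∈ range N, x i ≤ ∏ i ∈ range N, (1 - x i) := by
  induction N with
  | zero => simp
  | succ n ih =>
    rw [sum_range_succ, prod_range_succ]
    have hp : ∏ i ∈ range n, (1 - x i) ≤ 1 :=
      prod_le_one (fun i _ => by linarith [h1 i]) fun i _ => by linarith [h0 i]
    nlinarith [h0 n, h1 n]

/-- The nodes `0, 1, 8·1², 8·2², 8·3², …`. -/
def node : ℕ → ℕ
  | 0 => 0
  | 1 => 1
  | i + 2 => 8 * (i + 1) ^ 2

lemma node_strictMono : StrictMono node := by
  refine strictMono_nat_of_lt_succ fun n => ?_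
  match n with
  | 0 => simp [node]
  | 1 => simp [node]
  | n + 2 => simp only [node]; gcongr; omega

/-- The denominator of the `i`-th Lagrange weight for the nodes
`node 0, …, node (N + 1)`. -/
noncomputable def nodeDenom (N i : ℕ) : ℝ :=
  ∏ j ∈ (range (N + 2)).erase i, ((node i : ℝ) - node j)

lemma abs_nodeDenom (N i : ℕ) :
    |nodeDenom N i| = (∏ j ∈ range N, if j + 2 = i then 1 else |(node i : ℝ) - node (j + 2)|) *
      (if 1 = i then 1 else |(node i : ℝ) - 1|) * (if 0 = i then 1 else |(node i : ℝ)|) := by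
  have : ∀ s : Finset ℕ, ∀ f : ℕ → ℝ,
      ∏ j ∈ s.erase i, f j = ∏ j ∈ s, if j = i then 1 else f j := by
    intro s f
    rw [← prod_erase s (f := fun j => if j = i then 1 else f j) (a := i) (if_pos rfl)]
    exact prod_congr rfl fun j hj => (if_neg (mem_erase.1 hj).1).symm
  rw [nodeDenom, abs_prod, this, prod_range_succ', prod_range_succ']
  simp [node]

lemma nodeDenom_ne_zero (N i : ℕ) : nodeDenom N i ≠ 0 := by
  rw [nodeDenom, prod_ne_zero_iff]
  intro j hj
  rw [sub_ne_zero]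
  exact_mod_cast fun h => (mem_erase.1 hj).1 (node_strictMono.injective h).symm

lemma abs_nodeDenom_zero (N : ℕ) :
    |nodeDenom N 0| = ∏ j ∈ range N, (8 * ((j : ℝ) + 1) ^ 2) := by
  rw [abs_nodeDenom]
  simp [node, abs_mul, abs_of_nonneg]

lemma abs_nodeDenom_zero_le_one (N : ℕ) :
    |nodeDenom N 0| ≤ 4 / 3 * |nodeDenom N 1| := by
  have h1 : |nodeDenom N 1| = |nodeDenom N 0| *
      ∏ j ∈ range N, (1 - (8 * ((j : ℝ) + 1) ^ 2)⁻¹) := by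
    rw [abs_nodeDenom_zero, abs_nodeDenom, ← prod_mul_distrib]
    simp only [node, if_true, mul_one]
    norm_num
    refine prod_congr rfl fun j _ => ?_
    have : (1 : ℝ) ≤ ((j : ℝ) + 1) ^ 2 := by nlinarith [(Nat.cast_nonneg j : (0 : ℝ) ≤ j)]
    rw [if_neg (by omega), abs_sub_comm, abs_of_nonneg (by linarith)]
    field_simp
  have h2 := one_sub_sum_le_prod_one_sub N (fun j => (8 * ((j : ℝ) + 1) ^ 2)⁻¹)
    (fun j => by positivity) fun j => inv_le_one_of_one_le₀ (by
      nlinarith [(Nat.cast_nonneg j : (0 : ℝ) ≤ j)])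
  have h3 := sum_range_inv_sq_le N
  simp only [mul_inv, ← mul_sum] at h2
  simp only [mul_inv] at h1
  have : 3 / 4 ≤ ∏ j ∈ range N, (1 - 8⁻¹ * (((j : ℝ) + 1) ^ 2)⁻¹) := by linarith
  rw [h1]
  nlinarith [abs_nonneg (nodeDenom N 0)]

lemma abs_nodeDenom_zero_le_add_two (N i : ℕ) (hi : i < N) :
    |nodeDenom N 0| ≤ 2 / 7 * (((i : ℝ) + 1) ^ 2)⁻¹ * |nodeDenom N (i + 2)| := by
  have h := prod_scaled_sq_le i N hi
  rw [abs_nodeDenom_zero, abs_nodeDenom]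
  simp only [node, add_left_inj, show ¬ (1 = i + 2) by omega, show ¬ (0 = i + 2) by omega,
    if_false]
  push_cast
  set P := ∏ j ∈ range N,
        (if j = i then (1 : ℝ) else |8 * ((i : ℝ) + 1) ^ 2 - 8 * ((j : ℝ) + 1) ^ 2|)
  have hP0 : 0 ≤ P := prod_nonneg fun j _ => by split_ifs <;> positivity
  have ha : (1 : ℝ) ≤ ((i : ℝ) + 1) ^ 2 := by nlinarith [(Nat.cast_nonneg i : (0 : ℝ) ≤ i)]
  set a := ((i : ℝ) + 1) ^ 2
  rw [abs_of_nonneg (a := 8 * a - 1) (by linarith), abs_of_nonneg (a := 8 * a) (by linarith)]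
  refine h.trans ?_
  have : 2 / 7 * a⁻¹ * (P * (8 * a - 1) * (8 * a)) = 16 * P * ((8 * a - 1) / 7) := by
    field_simp
    ring
  rw [this]
  nlinarith

/-- A signed measure on the nodes, of mass `1` at `0` and total mass at most `3`, which annihilates
all polynomials of degree at most `N`. -/
lemma exists_annihilating_weights (N : ℕ) : ∃ r : ℕ → ℝ, r 0 = 1 ∧
    ∑ i ∈ range (N + 2), |r i| ≤ 3 ∧
    ∀ P : ℝ[X], P.natDegree ≤ N → ∑ i ∈ range (N + 2), r i * P.eval (node i : ℝ) = 0 := by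
  refine ⟨fun i => nodeDenom N 0 / nodeDenom N i, div_self (nodeDenom_ne_zero N 0), ?_, ?_⟩
  · have habs : ∀ i, 0 < |nodeDenom N i| := fun i => abs_pos.2 (nodeDenom_ne_zero N i)
    rw [sum_range_succ', sum_range_succ']
    simp only [abs_div]
    have h0 : |nodeDenom N 0| / |nodeDenom N 0| = 1 := div_self (habs 0).ne'
    have h1 : |nodeDenom N 0| / |nodeDenom N (0 + 1)| ≤ 4 / 3 :=
      (div_le_iff₀ (habs 1)).2 (abs_nodeDenom_zero_le_one N)
    have h2 : ∑ i ∈ range N, |nodeDenom N 0| / |nodeDenom N (i + 1 + 1)| ≤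
        ∑ i ∈ range N, 2 / 7 * (((i : ℝ) + 1) ^ 2)⁻¹ := sum_le_sum fun i hi =>
      (div_le_iff₀ (habs (i + 2))).2 (abs_nodeDenom_zero_le_add_two N i (mem_range.1 hi))
    rw [← mul_sum] at h2
    have h3 := sum_range_inv_sq_le N
    linarith
  · intro P hP
    have hdeg : P.degree < (#(range (N + 2)) : ℕ) := by
      rw [card_range]
      exact (P.degree_le_natDegree).trans_lt (by exact_mod_cast (by omega : P.natDegree < N + 2))
    have h := Lagrange.coeff_eq_sum (s := range (N + 2)) (v := fun i => (node i : ℝ))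
      (fun i _ j _ hij => node_strictMono.injective (Nat.cast_injective hij)) hdeg
    rw [card_range, Polynomial.coeff_eq_zero_of_natDegree_lt (by omega)] at h
    have : ∀ i, nodeDenom N 0 / nodeDenom N i * P.eval (node i : ℝ)
        = nodeDenom N 0 * (P.eval (node i : ℝ) / nodeDenom N i) := fun i => by ring
    simp only [this]
    rw [← mul_sum]
    exact mul_eq_zero_of_right _ h.symm

/-! ### A dual witness for the approximate degree of `OR` -/

/-- The string in `{-1, +1}^m` whose `-1` entries are exactly those in `T`. -/
def signString {m : ℕ} (T : Finset (Fin m)) : Fin m → ℤˣ := fun j => if j ∈ T then -1 else 1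

lemma signString_eq_neg_one {m : ℕ} (T : Finset (Fin m)) (j : Fin m) :
    signString T j = -1 ↔ j ∈ T := by
  unfold signString
  split_ifs with h <;> simp [h]

lemma signString_eq_one {m : ℕ} (T : Finset (Fin m)) (j : Fin m) :
    signString T j = 1 ↔ j ∉ T := by
  unfold signString
  split_ifs with h <;> simp [h]

/-- Subsets of `Fin m` correspond to strings in `{-1, +1}^m`. -/
def signStringEquiv (m : ℕ) : Finset (Fin m) ≃ (Fin m → ℤˣ) where
  toFun := signString
  invFun z := univ.filter fun j => z j = -1
  left_inv T := by ext j; simp [signString_eq_neg_one]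
  right_inv z := by
    funext j
    rcases Int.units_eq_one_or (z j) with h | h
    · rw [h, signString_eq_one]; simp [h]
    · rw [h, signString_eq_neg_one]; simp [h]

/-- The indicator function of the strings that are `-1` on `A` and `+1` on `A'`. -/
def patternIndicator {m : ℕ} (A A' : Finset (Fin m)) (z : Fin m → ℤˣ) : ℝ :=
  if (∀ j ∈ A, z j = -1) ∧ ∀ j ∈ A', z j = 1 then 1 else 0

lemma patternIndicator_insert {m : ℕ} (A A' : Finset (Fin m)) (x : Fin m) (z : Fin m → ℤˣ) :
    patternIndicator A (insert x A') z
      = patternIndicator A A' z - patternIndicator (insert x A) A' z := by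
  unfold patternIndicator
  simp only [forall_mem_insert]
  rcases Int.units_eq_one_or (z x) with h | h <;> simp [h]

/-- A function that depends only on the coordinates in `B` is a combination of indicators of
patterns on `B`. -/
lemma eq_sum_patternIndicator {m : ℕ} (B : Finset (Fin m)) (h : (Fin m → ℤˣ) → ℝ)
    (hB : ∀ z z', (∀ j ∈ B, z j = z' j) → h z = h z') (z : Fin m → ℤˣ) :
    h z = ∑ u ∈ B.powerset, patternIndicator u (B \ u) z * h (signString u) := by
  have hz : ∀ j, z j ≠ -1 ↔ z j = 1 := fun j => by
    rcases Int.units_eq_one_or (z j) with h | h <;> simp [h]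
  rw [sum_eq_single (B.filter fun j => z j = -1)]
  · rw [patternIndicator, if_pos, one_mul]
    · refine hB _ _ fun j hj => ?_
      rcases Int.units_eq_one_or (z j) with h | h
      · rw [h, eq_comm, signString_eq_one]; simp [h]
      · rw [h, eq_comm, signString_eq_neg_one]; simp [h, hj]
    · refine ⟨fun j hj => (mem_filter.1 hj).2, fun j hj => ?_⟩
      rw [mem_sdiff, mem_filter] at hj
      exact (hz j).1 fun h' => hj.2 ⟨hj.1, h'⟩
  · intro u hu hne
    rw [patternIndicator, if_neg, zero_mul]
    rintro ⟨h1, h2⟩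
    refine hne (Finset.ext fun j => ⟨fun hj => ?_, fun hj => ?_⟩)
    · exact mem_filter.2 ⟨mem_powerset.1 hu hj, h1 j hj⟩
    · rw [mem_filter] at hj
      by_contra hju
      exact (hz j).2 (h2 j (mem_sdiff.2 ⟨hj.1, hju⟩)) hj.2
  · intro hn
    exact absurd (mem_powerset.2 (filter_subset _ _)) hn

/-- If `ψ` is orthogonal to all conjunctions of at most `N` variables, then it is orthogonal to
every function of at most `N` variables. -/
lemma sum_mul_eq_zero_of_conjunctions {m N : ℕ} (ψ : (Fin m → ℤˣ) → ℝ)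
    (hψ : ∀ A : Finset (Fin m), #A ≤ N → ∑ z, ψ z * patternIndicator A ∅ z = 0)
    (B : Finset (Fin m)) (hBN : #B ≤ N) (h : (Fin m → ℤˣ) → ℝ)
    (hB : ∀ z z', (∀ j ∈ B, z j = z' j) → h z = h z') : ∑ z, ψ z * h z = 0 := by
  have key : ∀ A' A : Finset (Fin m), #A + #A' ≤ N → ∑ z, ψ z * patternIndicator A A' z = 0 := by
    intro A'
    induction A' using Finset.induction_on with
    | empty => exact fun A hA => hψ A (by simpa using hA)
    | insert x A' hx ih =>
      intro A hA
      rw [card_insert_of_notMem hx] at hA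
      simp only [patternIndicator_insert, mul_sub, sum_sub_distrib]
      rw [ih A (by omega), ih (insert x A) (by have := card_insert_le x A; omega), sub_zero]
  rw [sum_congr rfl fun z _ => by rw [eq_sum_patternIndicator B h hB z, mul_sum], sum_comm]
  refine sum_eq_zero fun u hu => ?_
  simp only [← mul_assoc]
  rw [← sum_mul, key, zero_mul]
  rw [card_sdiff_of_subset (mem_powerset.1 hu)]
  have := card_le_card (mem_powerset.1 hu)
  omega

/-- The uniform probability distribution on the strings with exactly `t` entries `-1`. -/
noncomputable def layer (m t : ℕ) (z : Fin m → ℤˣ) : ℝ :=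
  if #(univ.filter fun j => z j = -1) = t then ((m.choose t : ℕ) : ℝ)⁻¹ else 0

lemma sum_layer_mul (m t : ℕ) (h : (Fin m → ℤˣ) → ℝ) :
    ∑ z, layer m t z * h z
      = ((m.choose t : ℕ) : ℝ)⁻¹ * ∑ T ∈ powersetCard t univ, h (signString T) := by
  rw [← Equiv.sum_comp (signStringEquiv m), powersetCard_eq_filter, powerset_univ, sum_filter,
    mul_sum]
  refine sum_congr rfl fun T _ => ?_
  have : (univ.filter fun j => signString T j = -1) = T := (signStringEquiv m).left_inv T
  change layer m t (signString T) * h (signString T) = _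
  rw [layer, this]
  split_ifs <;> simp

lemma sum_layer {m t : ℕ} (ht : t ≤ m) : ∑ z, layer m t z = 1 := by
  have h := sum_layer_mul m t fun _ => 1
  simp only [mul_one, sum_const, card_powersetCard, card_univ, Fintype.card_fin,
    nsmul_eq_mul] at h
  rw [h, inv_mul_cancel₀]
  exact_mod_cast (Nat.choose_pos ht).ne'

lemma layer_nonneg (m t : ℕ) (z : Fin m → ℤˣ) : 0 ≤ layer m t z := by
  unfold layer
  split_ifs <;> positivity

lemma sum_layer_mul_conjunction {m t : ℕ} (ht : t ≤ m) (A : Finset (Fin m)) :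
    ∑ z, layer m t z * patternIndicator A ∅ z = (t.choose #A : ℝ) / (m.choose #A : ℝ) := by
  have hA : #A ≤ m := by simpa using card_le_univ A
  have hcount : ∑ T ∈ powersetCard t univ, patternIndicator A ∅ (signString T)
      = #((powersetCard t univ).filter (A ⊆ ·)) := by
    rw [card_filter]
    push_cast
    refine sum_congr rfl fun T _ => ?_
    simp only [patternIndicator, signString_eq_neg_one, notMem_empty, false_imp_iff, implies_true,
      and_true]
    exact if_congr Iff.rfl rfl rfl
  have h1 : (0 : ℝ) < m.choose t := by exact_mod_cast Nat.choose_pos ht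
  have h2 : (0 : ℝ) < m.choose #A := by exact_mod_cast Nat.choose_pos hA
  rw [sum_layer_mul, hcount]
  rcases le_or_gt #A t with hle | hgt
  · rw [card_filter_powersetCard_subset A univ t (subset_univ A) hle, card_univ, Fintype.card_fin]
    have h3 := Nat.choose_mul (n := m) (k := t) (s := #A) hle
    have h3' : (m.choose t : ℝ) * t.choose #A = m.choose #A * (m - #A).choose (t - #A) := by
      exact_mod_cast h3
    field_simp
    linarith
  · rw [Nat.choose_eq_zero_of_lt hgt, filter_eq_empty_iff.2]
    · simp
    · intro T hT hsub
      have := card_le_card hsub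
      rw [(mem_powersetCard.1 hT).2] at this
      omega

/-- A dual witness for the approximate degree of `OR`: a signed measure of total mass at most `1`
which has correlation `2 / 3` with `OR`, but is orthogonal to every function of at most `N`
coordinates, where `N` is of the order of the square root of the number of coordinates. -/
lemma exists_or_dual {m N : ℕ} (hN : 1 ≤ N) (hm : 8 * N ^ 2 ≤ m) :
    ∃ ψ : (Fin m → ℤˣ) → ℝ, ∑ z, |ψ z| ≤ 1 ∧ ∑ z, ψ z * ((orFn m z : ℤ) : ℝ) = 2 / 3 ∧
      ∀ B : Finset (Fin m), #B ≤ N → ∀ h : (Fin m → ℤˣ) → ℝ,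
        (∀ z z', (∀ j ∈ B, z j = z' j) → h z = h z') → ∑ z, ψ z * h z = 0 := by
  obtain ⟨r, hr0, hr1, hr2⟩ := exists_annihilating_weights N
  have hnode : ∀ i ∈ range (N + 2), node i ≤ m := by
    intro i hi
    refine (node_strictMono.monotone (by have := mem_range.1 hi; omega : i ≤ N + 1)).trans ?_
    obtain ⟨M, rfl⟩ : ∃ M, N = M + 1 := ⟨N - 1, by omega⟩
    exact hm
  set ψ : (Fin m → ℤˣ) → ℝ := fun z => 3⁻¹ * ∑ i ∈ range (N + 2), r i * layer m (node i) z with hψ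
  have hsum : ∀ h : (Fin m → ℤˣ) → ℝ, ∑ z, ψ z * h z
      = 3⁻¹ * ∑ i ∈ range (N + 2), r i * ∑ z, layer m (node i) z * h z := by
    intro h
    simp only [hψ, mul_assoc, sum_mul, ← mul_sum]
    rw [sum_comm]
    simp only [mul_sum]
  have horth : ∀ B : Finset (Fin m), #B ≤ N → ∀ h : (Fin m → ℤˣ) → ℝ,
        (∀ z z', (∀ j ∈ B, z j = z' j) → h z = h z') → ∑ z, ψ z * h z = 0 := by
    refine sum_mul_eq_zero_of_conjunctions ψ fun A hA => ?_
    rw [hsum]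
    refine mul_eq_zero_of_right _ ?_
    -- The average of a conjunction over a layer is a polynomial in the index of the layer.
    set P : ℝ[X] := Polynomial.C (((#A)! : ℝ) * m.choose #A)⁻¹ * descPochhammer ℝ #A with hP
    have hPd : P.natDegree ≤ N :=
      (Polynomial.natDegree_C_mul_le _ _).trans ((descPochhammer_natDegree (R := ℝ) #A).le.trans hA)
    rw [← hr2 P hPd]
    refine sum_congr rfl fun i hi => ?_
    rw [sum_layer_mul_conjunction (hnode i hi), hP, Polynomial.eval_C_mul,
      descPochhammer_eval_eq_descFactorial, Nat.descFactorial_eq_factorial_mul_choose]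
    have : ((#A)! : ℝ) ≠ 0 := by exact_mod_cast Nat.factorial_ne_zero _
    push_cast
    rw [mul_inv]
    field_simp
  refine ⟨ψ, ?_, ?_, horth⟩
  · calc ∑ z, |ψ z| ≤ ∑ z, 3⁻¹ * ∑ i ∈ range (N + 2), |r i| * layer m (node i) z := by
          refine sum_le_sum fun z _ => ?_
          rw [hψ, abs_mul, abs_of_pos (by norm_num : (0 : ℝ) < 3⁻¹)]
          gcongr
          refine (abs_sum_le_sum_abs _ _).trans (sum_le_sum fun i _ => ?_)
          rw [abs_mul, abs_of_nonneg (layer_nonneg _ _ _)]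
      _ = 3⁻¹ * ∑ i ∈ range (N + 2), |r i| := by
          rw [← mul_sum, sum_comm]
          congr 1
          refine sum_congr rfl fun i hi => ?_
          rw [← mul_sum, sum_layer (hnode i hi), mul_one]
      _ ≤ 1 := by linarith
  · have h0 : ∑ z, ψ z = 0 := by
      simpa using horth ∅ (by simp) (fun _ => 1) fun _ _ _ => rfl
    have hor : ∀ z : Fin m → ℤˣ, ((orFn m z : ℤ) : ℝ) = 2 * (if z = 1 then 1 else 0) - 1 := by
      intro z
      unfold orFn
      by_cases hz : z = 1
      · subst hz; simp; norm_num
      · have : ∃ j, z j = -1 := by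
          by_contra hcon
          push Not at hcon
          exact hz (funext fun j => (Int.units_eq_one_or (z j)).resolve_right (hcon j))
        simp [hz, this]
    have h1 : ψ 1 = 3⁻¹ := by
      have hl : ∀ i, layer m (node i) 1 = if i = 0 then 1 else 0 := by
        intro i
        have : (univ.filter fun j => (1 : Fin m → ℤˣ) j = -1) = ∅ := by
          ext j; simp
        rw [layer, this, card_empty]
        by_cases hi : i = 0
        · subst hi; simp [node]
        · have := node_strictMono (Nat.pos_of_ne_zero hi)
          rw [if_neg ((Nat.zero_le _).trans_lt this).ne, if_neg hi]
      simp [hψ, hl, hr0]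
    simp only [hor, mul_sub, mul_one, sum_sub_distrib, h0]
    simp [h1]
    norm_num

/-! ### Protocols and cylinder intersections -/

/-- `χ` is a family of functions, bounded by `1`, of which the `i`-th does not depend on the input
of player `i`. Inputs are parametrized by a map `T`. The products `∏ i, χ i` generalize the
indicator functions of cylinder intersections. -/
structure IsCylinderFamily {k : ℕ} {X : Fin k → Type} {Ω : Type*} (T : Ω → ∀ i, X i)
    (χ : Fin k → Ω → ℝ) : Prop where
  abs_le_one : ∀ i ω, |χ i ω| ≤ 1
  indep : ∀ i ω ω', (∀ j, j ≠ i → T ω j = T ω' j) → χ i ω = χ i ω'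

/-- A protocol of cost `c` is a signed sum of at most `2 ^ c` cylinder intersections, hence its
correlation with `A` is at most `2 ^ c` times the largest correlation of a cylinder intersection. -/
lemma abs_sum_mul_eval_le {k : ℕ} {X : Fin k → Type} {Ω : Type*} [Fintype Ω] (T : Ω → ∀ i, X i)
    (A : Ω → ℝ) (M : ℝ) (hM : ∀ χ, IsCylinderFamily T χ → |∑ ω, A ω * ∏ i, χ i ω| ≤ M)
    (p : NOFProtocol X) : ∀ χ, IsCylinderFamily T χ →
      |∑ ω, A ω * (∏ i, χ i ω) * ((p.eval (T ω) : ℤ) : ℝ)| ≤ 2 ^ p.cost * M := by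
  induction p with
  | output b =>
    intro χ hχ
    have h := hM χ hχ
    rcases Int.units_eq_one_or b with rfl | rfl <;> simpa [NOFProtocol.eval, NOFProtocol.cost]
  | speak i msg next ih =>
    intro χ hχ
    have hM0 : 0 ≤ M := (abs_nonneg _).trans (hM χ hχ)
    set ind : Bool → Ω → ℝ := fun b ω => if msg (fun j => T ω j.1) = b then 1 else 0 with hind
    set χ' : Bool → Fin k → Ω → ℝ := fun b j ω => χ j ω * if j = i then ind b ω else 1 with hχ'
    have hχ'c : ∀ b, IsCylinderFamily T (χ' b) := by
      refine fun b => ⟨fun j ω => ?_, fun j ω ω' h => ?_⟩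
      · rw [hχ', abs_mul]
        refine mul_le_one₀ (hχ.abs_le_one j ω) (abs_nonneg _) ?_
        simp only [hind]
        split_ifs <;> simp
      · simp only [hχ']
        rw [hχ.indep j ω ω' h]
        split_ifs with hji
        · subst hji
          have : (fun l : {l : Fin k // l ≠ j} => T ω l.1) 
              = fun l : {l : Fin k // l ≠ j} => T ω' l.1 :=
            funext fun l => h l.1 l.2
          simp only [hind, this]
        · rfl
    have hprod : ∀ b ω, ∏ j, χ' b j ω = (∏ j, χ j ω) * ind b ω := by
      intro b ω
      simp only [hχ', prod_mul_distrib, prod_ite_eq', mem_univ, if_true]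
    have hsplit : ∑ ω, A ω * (∏ i, χ i ω) * (((NOFProtocol.speak i msg next).eval (T ω) : ℤ) : ℝ)
        = ∑ ω, A ω * (∏ i, χ' false i ω) * (((next false).eval (T ω) : ℤ) : ℝ)
          + ∑ ω, A ω * (∏ i, χ' true i ω) * (((next true).eval (T ω) : ℤ) : ℝ) := by
      rw [← sum_add_distrib]
      refine sum_congr rfl fun ω _ => ?_
      rw [hprod, hprod, NOFProtocol.eval]
      simp only [hind]
      cases msg (fun j => T ω j.1) <;> simp
    rw [hsplit]
    have hle : ∀ b, (2 : ℝ) ^ (next b).cost * M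
        ≤ 2 ^ max (next false).cost (next true).cost * M := fun b => by
      gcongr
      · norm_num
      · cases b
        · exact le_max_left _ _
        · exact le_max_right _ _
    have h1 := (ih false _ (hχ'c false)).trans (hle false)
    have h2 := (ih true _ (hχ'c true)).trans (hle true)
    refine (abs_add_le _ _).trans ?_
    rw [NOFProtocol.cost, pow_succ]
    linarith

/-- The easy direction of Yao's principle: some deterministic protocol in the support has small
average error with respect to a given weight function on inputs. -/
lemma exists_protocol_average_error_le {k : ℕ} {X : Fin k → Type} {Ω : Type*} [Fintype Ω]
    (T : Ω → ∀ i, X i) (w : Ω → ℝ) (hw : ∀ ω, 0 ≤ w ω) {ε : ℝ} (hε : 0 ≤ ε)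
    (f : (∀ i, X i) → ℤˣ) (P : PMF (NOFProtocol X))
    (hP : ∀ x, P.toOuterMeasure {p | p.eval x ≠ f x} ≤ ENNReal.ofReal ε) :
    ∃ p ∈ P.support, ∑ ω, w ω * (if p.eval (T ω) ≠ f (T ω) then 1 else 0) ≤ ε * ∑ ω, w ω := by
  by_contra! hcon
  set W : NOFProtocol X → ℝ := fun p =>
    ∑ ω, w ω * (if p.eval (T ω) ≠ f (T ω) then 1 else 0) with hW
  have hsum : ∑' p, P p * ENNReal.ofReal (W p) ≤ ENNReal.ofReal (ε * ∑ ω, w ω) := by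
    have h1 : ∀ p, P p * ENNReal.ofReal (W p) = ∑ ω, ENNReal.ofReal (w ω) *
        ({p : NOFProtocol X | p.eval (T ω) ≠ f (T ω)}.indicator P p) := by
      intro p
      rw [hW, ENNReal.ofReal_sum_of_nonneg fun ω _ => mul_nonneg (hw ω) (by split_ifs <;> simp),
        mul_sum]
      refine sum_congr rfl fun ω _ => ?_
      rw [ENNReal.ofReal_mul (hw ω), Set.indicator_apply]
      simp only [Set.mem_ofPred_eq]
      split_ifs <;> simp [mul_comm]
    simp only [h1]
    rw [Summable.tsum_finsetSum fun _ _ => ENNReal.summable]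
    calc ∑ ω, ∑' p, ENNReal.ofReal (w ω) *
          ({p : NOFProtocol X | p.eval (T ω) ≠ f (T ω)}.indicator P p)
        ≤ ∑ ω, ENNReal.ofReal (w ω) * ENNReal.ofReal ε := by
          refine sum_le_sum fun ω _ => ?_
          rw [ENNReal.tsum_mul_left, ← PMF.toOuterMeasure_apply]
          gcongr
          exact hP _
      _ = ENNReal.ofReal (ε * ∑ ω, w ω) := by
          rw [← sum_mul, ← ENNReal.ofReal_sum_of_nonneg fun ω _ => hw ω, mul_comm,
            ENNReal.ofReal_mul hε]
  obtain ⟨p₀, hp₀⟩ := P.support_nonempty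
  have hconst : ∑' p, P p * ENNReal.ofReal (ε * ∑ ω, w ω) = ENNReal.ofReal (ε * ∑ ω, w ω) := by
    rw [ENNReal.tsum_mul_right, P.tsum_coe, one_mul]
  refine hsum.not_gt ?_
  rw [← hconst]
  have hεw : 0 ≤ ε * ∑ ω, w ω := mul_nonneg hε (sum_nonneg fun ω _ => hw ω)
  refine ENNReal.tsum_lt_tsum (i := p₀) (by rw [hconst]; exact ENNReal.ofReal_ne_top)
    (fun p => ?_) ?_
  · by_cases hp : p ∈ P.support
    · gcongr
      exact (hcon p hp).le
    · rw [(PMF.apply_eq_zero_iff P p).2 hp, zero_mul, zero_mul]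
  · refine ENNReal.mul_lt_mul_right ((PMF.mem_support_iff P p₀).1 hp₀) (P.apply_ne_top p₀) ?_
    exact (ENNReal.ofReal_lt_ofReal_iff (hεw.trans_lt (hcon p₀ hp₀))).2 (hcon p₀ hp₀)

/-! ### The box norm inequality -/

lemma expect_fin_cons {K : ℕ} {α : Type*} [Fintype α] (F : (Fin (K + 1) → α) → ℝ) :
    𝔼 y, F y = 𝔼 a, 𝔼 y, F (Fin.cons a y) := by
  rw [← expect_product', univ_product_univ]
  exact (Fintype.expect_equiv (Fin.consEquiv fun _ => α) _ _ fun _ => rfl).symm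

lemma prod_fin_cons_bool {K : ℕ} (F : (Fin (K + 1) → Bool) → ℝ) :
    ∏ u, F u = ∏ u, F (Fin.cons false u) * F (Fin.cons true u) := by
  rw [← Equiv.prod_comp (Fin.consEquiv fun _ => Bool), Fintype.prod_prod_type_right]
  simp [Fin.consEquiv, mul_comm]

lemma sq_expect_le {ι : Type*} [Fintype ι] (f : ι → ℝ) : (𝔼 i, f i) ^ 2 ≤ 𝔼 i, f i ^ 2 := by
  rcases isEmpty_or_nonempty ι with h | h
  · simp [Finset.univ_eq_empty]
  · simpa using expect_mul_sq_le_sq_mul_sq univ f fun _ => 1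

/-- The vertex of a combinatorial box selected by `u`: for each `i`, `u i` says which of the two
entries of `w i` is taken. -/
def boxVertex {K : ℕ} {Y : Type*} (u : Fin K → Bool) (w : Fin K → Y × Y) : Fin K → Y :=
  fun i => if u i then (w i).2 else (w i).1

lemma boxVertex_cons {K : ℕ} {Y : Type*} (b : Bool) (u : Fin K → Bool) (p : Y × Y)
    (w : Fin K → Y × Y) : boxVertex (Fin.cons b u) (Fin.cons p w)
      = Fin.cons (if b then p.2 else p.1) (boxVertex u w) := by
  funext i
  refine Fin.cases ?_ (fun j => ?_) i <;> simp [boxVertex]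

/-- The Cauchy-Schwarz inequality applied once to each of the `K` variables `y i`: the correlation
of `g` with a product of bounded functions, each of which ignores one of the variables, is at most
the box norm of `g`. -/
lemma expect_mul_prod_pow_le_box {K : ℕ} {Y : Type} [Fintype Y] [Nonempty Y] :
    ∀ {Z : Type} [Fintype Z] (g : Z → (Fin K → Y) → ℝ) (χ : Fin K → Z → (Fin K → Y) → ℝ),
      (∀ i z y, |χ i z y| ≤ 1) → (∀ i z y y', (∀ j, j ≠ i → y j = y' j) → χ i z y = χ i z y') →
      (𝔼 z, 𝔼 y, g z y * ∏ i, χ i z y) ^ 2 ^ K ≤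
        𝔼 z, 𝔼 w : Fin K → Y × Y, ∏ u, g z (boxVertex u w) := by
  induction K with
  | zero =>
    intro Z _ g χ _ _
    have h : ∀ {α : Type} [Fintype α] (F : (Fin 0 → α) → ℝ) (a), 𝔼 y, F y = F a := fun F a => by
      rw [Fintype.expect_eq_sum_div_card]
      simp [Subsingleton.elim a default]
    refine le_of_eq ?_
    simp only [pow_zero, pow_one, univ_eq_empty, prod_empty, mul_one, Fintype.prod_unique]
    refine expect_congr rfl fun z _ => ?_
    rw [h _ (fun i => i.elim0), h _ (fun i => i.elim0)]
    congr 1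
    exact Subsingleton.elim _ _
  | succ K ih =>
    intro Z _ g χ hb hi
    obtain ⟨c⟩ := ‹Nonempty Y›
    have hle : (𝔼 z, 𝔼 y, g z y * ∏ i, χ i z y) ^ 2 ≤
        𝔼 z, 𝔼 y' : Fin K → Y, (𝔼 a, g z (Fin.cons a y') *
          ∏ i : Fin K, χ i.succ z (Fin.cons a y')) ^ 2 := by
      refine (sq_expect_le _).trans (expect_le_expect fun z _ => ?_)
      have : 𝔼 y, g z y * ∏ i, χ i z y = 𝔼 y' : Fin K → Y, χ 0 z (Fin.cons c y') *
          𝔼 a, g z (Fin.cons a y') * ∏ i : Fin K, χ i.succ z (Fin.cons a y') := by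
        rw [expect_fin_cons, expect_comm]
        refine expect_congr rfl fun y' _ => ?_
        rw [mul_expect]
        refine expect_congr rfl fun a _ => ?_
        rw [Fin.prod_univ_succ, hi 0 z (Fin.cons a y') (Fin.cons c y')]
        · ring
        · intro j hj
          obtain ⟨l, rfl⟩ := Fin.exists_succ_eq.2 hj
          simp
      rw [this]
      refine (sq_expect_le _).trans (expect_le_expect fun y' _ => ?_)
      rw [mul_pow]
      refine mul_le_of_le_one_left (sq_nonneg _) ?_
      rw [← sq_abs]
      exact pow_le_one₀ (abs_nonneg _) (hb _ _ _)
    have hdouble : 𝔼 z, 𝔼 y' : Fin K → Y, (𝔼 a, g z (Fin.cons a y') *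
          ∏ i : Fin K, χ i.succ z (Fin.cons a y')) ^ 2
        = 𝔼 z : Z × Y × Y, 𝔼 y' : Fin K → Y,
          (g z.1 (Fin.cons z.2.1 y') * g z.1 (Fin.cons z.2.2 y')) *
          ∏ i : Fin K, (χ i.succ z.1 (Fin.cons z.2.1 y') * χ i.succ z.1 (Fin.cons z.2.2 y')) := by
      rw [← univ_product_univ, expect_product]
      refine expect_congr rfl fun z _ => ?_
      rw [expect_comm]
      refine expect_congr rfl fun y' _ => ?_
      rw [← univ_product_univ, expect_product, sq, expect_mul_expect]
      refine expect_congr rfl fun a _ => expect_congr rfl fun b _ => ?_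
      rw [prod_mul_distrib]
      ring
    have hbox : 𝔼 z : Z × Y × Y, 𝔼 w : Fin K → Y × Y,
          ∏ u, (g z.1 (Fin.cons z.2.1 (boxVertex u w)) * g z.1 (Fin.cons z.2.2 (boxVertex u w)))
        = 𝔼 z, 𝔼 w : Fin (K + 1) → Y × Y, ∏ u, g z (boxVertex u w) := by
      rw [← univ_product_univ, expect_product]
      refine expect_congr rfl fun z _ => ?_
      rw [expect_fin_cons]
      refine expect_congr rfl fun p _ => expect_congr rfl fun w _ => ?_
      rw [prod_fin_cons_bool]
      simp [boxVertex_cons]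
    rw [pow_succ', pow_mul]
    refine (pow_le_pow_left₀ (sq_nonneg _) hle _).trans ?_
    rw [hdouble, ← hbox]
    have : Nonempty Y := ⟨c⟩
    refine ih (Z := Z × Y × Y) _ (fun i z y' =>
      χ i.succ z.1 (Fin.cons z.2.1 y') * χ i.succ z.1 (Fin.cons z.2.2 y')) ?_ ?_
    · intro i z y
      rw [abs_mul]
      exact mul_le_one₀ (hb _ _ _) (abs_nonneg _) (hb _ _ _)
    · intro i z y y' h
      have hcons : ∀ a : Y, ∀ j, j ≠ i.succ →
          (Fin.cons a y : Fin (K + 1) → Y) j = (Fin.cons a y' : Fin (K + 1) → Y) j := by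
        intro a j
        refine Fin.cases (fun _ => rfl) (fun l hl => ?_) j
        simpa using h l fun hli => hl (by rw [hli])
      simp only [hi i.succ z.1 _ _ (hcons _)]

/-! ### Reading a random table at several tuples of addresses -/

/-- A table `x` has `m` rows indexed by addresses in `L`. `readTable x a` is the string of length
`m` whose `j`-th entry is found in row `j` at the address `a j`. -/
def readTable {m : ℕ} {L : Type*} (x : Fin m × L → ℤˣ) (a : Fin m → L) : Fin m → ℤˣ :=
  fun j => x (j, a j)

/-- The table with the entries of `z` in the cells selected by `a`, and `1` in all other cells.
Multiplication by such tables is used to resample the cells selected by `a`. -/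
def spread {m : ℕ} {L : Type*} [DecidableEq L] (a : Fin m → L) (z : Fin m → ℤˣ) :
    Fin m × L → ℤˣ :=
  fun c => if c.2 = a c.1 then z c.1 else 1

lemma readTable_spread_mul {m : ℕ} {L : Type*} [DecidableEq L] (a : Fin m → L) (z : Fin m → ℤˣ)
    (x : Fin m × L → ℤˣ) : readTable (spread a z * x) a = z * readTable x a := by
  funext j
  simp [readTable, spread]

/-- The reading of a uniformly random table is uniformly distributed. -/
lemma expect_readTable {m : ℕ} {L : Type*} [Fintype L] [DecidableEq L] (a : Fin m → L)
    (G : (Fin m → ℤˣ) → ℝ) :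
    𝔼 x : Fin m × L → ℤˣ, G (readTable x a) = 𝔼 z, G z := by
  have hshift : ∀ z, 𝔼 x, G (z * readTable x a) = 𝔼 x, G (readTable x a) := fun z =>
    Fintype.expect_equiv (Equiv.mulLeft (spread a z)) _ _ fun x => by
      rw [Equiv.coe_mulLeft, readTable_spread_mul]
  have htrans : ∀ x : Fin m × L → ℤˣ, 𝔼 z, G (z * readTable x a) = 𝔼 z, G z := fun x =>
    Fintype.expect_equiv (Equiv.mulRight (readTable x a)) _ _ fun z => rfl
  calc 𝔼 x : Fin m × L → ℤˣ, G (readTable x a)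
      = 𝔼 z : Fin m → ℤˣ, 𝔼 x : Fin m × L → ℤˣ, G (z * readTable x a) := by
        simp only [hshift, Fintype.expect_const]
    _ = 𝔼 z, G z := by
        rw [expect_comm]
        simp only [htrans, Fintype.expect_const]

/-- If on all rows outside `B` the address `a u₀` differs from all other addresses, then averaging
over the cells read by `a u₀` outside `B` shows that the correlations of the readings vanish,
provided `ψ` is orthogonal to all functions of the coordinates in `B`. -/
lemma sum_prod_readTable_eq_zero {m : ℕ} {L U : Type*} [Fintype L] [DecidableEq L] [Fintype U]
    [DecidableEq U] (ψ : (Fin m → ℤˣ) → ℝ) (B : Finset (Fin m))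
    (hψ : ∀ h : (Fin m → ℤˣ) → ℝ, (∀ z z', (∀ j ∈ B, z j = z' j) → h z = h z') →
      ∑ z, ψ z * h z = 0)
    (a : U → Fin m → L) (u₀ : U) (ha : ∀ j ∉ B, ∀ u ≠ u₀, a u j ≠ a u₀ j) :
    ∑ x : Fin m × L → ℤˣ, ∏ u, ψ (readTable x (a u)) = 0 := by
  set F : (Fin m × L → ℤˣ) → ℝ := fun x => ∏ u, ψ (readTable x (a u)) with hF
  have hshift : ∀ z, ∑ x, F (spread (a u₀) z * x) = ∑ x, F x := fun z =>
    Equiv.sum_comp (Equiv.mulLeft (spread (a u₀) z)) F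
  have hzero : ∀ x, ∑ z, F (spread (a u₀) z * x) = 0 := by
    intro x
    rw [← Equiv.sum_comp (Equiv.mulRight (readTable x (a u₀))⁻¹)]
    set h : (Fin m → ℤˣ) → ℝ := fun z =>
      ∏ u ∈ univ.erase u₀,
        ψ (readTable (spread (a u₀) (z * (readTable x (a u₀))⁻¹) * x) (a u))
    rw [← hψ h]
    · refine sum_congr rfl fun z _ => ?_
      simp only [hF, Equiv.coe_mulRight]
      rw [← mul_prod_erase univ _ (mem_univ u₀), readTable_spread_mul, inv_mul_cancel_right]
    · intro z z' hz
      refine prod_congr rfl fun u hu => ?_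
      congr 1
      funext j
      simp only [readTable, spread, Pi.mul_apply]
      by_cases hj : j ∈ B
      · rw [hz j hj]
      · rw [if_neg (ha j hj u (mem_erase.1 hu).1), if_neg (ha j hj u (mem_erase.1 hu).1)]
  have hcard : (Fintype.card (Fin m → ℤˣ) : ℝ) * ∑ x, F x = 0 := by
    calc (Fintype.card (Fin m → ℤˣ) : ℝ) * ∑ x, F x = ∑ z, ∑ x, F (spread (a u₀) z * x) := by
          simp [hshift]
      _ = 0 := by
          rw [sum_comm]
          exact sum_eq_zero fun x _ => hzero x
  refine (mul_eq_zero.1 hcard).resolve_left ?_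
  exact_mod_cast Fintype.card_ne_zero

/-- The joint readings determine all cells at which some reading looks, so that a tuple of readings
is attained by few tables. -/
lemma sum_prod_abs_readTable_le {m : ℕ} {L U : Type*} [Fintype L] [DecidableEq L] [Fintype U]
    [DecidableEq U] (ψ : (Fin m → ℤˣ) → ℝ) (hψ : ∑ z, |ψ z| ≤ 1) (a : U → Fin m → L) :
    ∑ x : Fin m × L → ℤˣ, ∏ u, |ψ (readTable x (a u))| ≤
      ∏ j, (2 : ℝ) ^ Fintype.card L / 2 ^ #(univ.image fun u => a u j) := by
  set S : Fin m → Finset L := fun j => univ.image fun u => a u j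
  set R : (Fin m × L → ℤˣ) → U → Fin m → ℤˣ := fun x u => readTable x (a u)
  set G : (U → Fin m → ℤˣ) → ℝ := fun w => ∏ u, |ψ (w u)| with hG
  have hG0 : ∀ w, 0 ≤ G w := fun w => prod_nonneg fun u _ => abs_nonneg _
  have hfiber : ∀ w, (#(univ.filter fun x => R x = w) : ℝ) ≤
      ∏ j, (2 : ℝ) ^ Fintype.card L / 2 ^ #(S j) := by
    intro w
    have hcount : (∏ c : Fin m × L, (if c.2 ∈ S c.1 then 1 else 2) : ℝ) =
        ∏ j, (2 : ℝ) ^ Fintype.card L / 2 ^ #(S j) := by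
      rw [Fintype.prod_prod_type]
      refine prod_congr rfl fun j _ => ?_
      change (∏ l, if l ∈ S j then 1 else 2 : ℝ) = _
      rw [prod_ite, prod_const_one, one_mul, prod_const, filter_not,
        card_sdiff_of_subset (subset_univ _), card_univ, pow_sub₀ _ two_ne_zero (card_le_univ _),
        filter_univ_mem, div_eq_mul_inv]
    rw [← hcount]
    rcases (univ.filter fun x => R x = w).eq_empty_or_nonempty with he | ⟨x₀, hx₀⟩
    · rw [he, card_empty, Nat.cast_zero]
      exact prod_nonneg fun c _ => by split_ifs <;> norm_num
    · have hsub : (univ.filter fun x => R x = w) ⊆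
          Fintype.piFinset fun c : Fin m × L => if c.2 ∈ S c.1 then {x₀ c} else univ := by
        intro x hx
        rw [Fintype.mem_piFinset]
        rintro ⟨j, l⟩
        split_ifs with hc
        · obtain ⟨u, -, hu⟩ := mem_image.1 hc
          have hu : a u j = l := hu
          subst hu
          have h1 : R x u j = R x₀ u j := by rw [(mem_filter.1 hx).2, (mem_filter.1 hx₀).2]
          exact mem_singleton.2 h1
        · exact mem_univ _
      have := card_le_card hsub
      rw [Fintype.card_piFinset] at this
      refine (Nat.cast_le.2 this).trans (le_of_eq ?_)
      push_cast
      refine prod_congr rfl fun c _ => ?_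
      split_ifs <;> simp
  calc ∑ x : Fin m × L → ℤˣ, ∏ u, |ψ (readTable x (a u))|
      = ∑ w, ∑ x ∈ univ.filter (fun x => R x = w), G (R x) :=
        (sum_fiberwise univ R fun x => G (R x)).symm
    _ = ∑ w, (#(univ.filter fun x => R x = w) : ℝ) * G w := by
        refine sum_congr rfl fun w _ => ?_
        rw [sum_congr rfl fun x hx => by rw [(mem_filter.1 hx).2], sum_const, nsmul_eq_mul]
    _ ≤ ∑ w, (∏ j, (2 : ℝ) ^ Fintype.card L / 2 ^ #(S j)) * G w :=
        sum_le_sum fun w _ => mul_le_mul_of_nonneg_right (hfiber w) (hG0 w)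
    _ ≤ ∏ j, (2 : ℝ) ^ Fintype.card L / 2 ^ #(S j) := by
        rw [← mul_sum]
        refine mul_le_of_le_one_right (prod_nonneg fun j _ => by positivity) ?_
        have : ∑ w, G w = ∏ _u : U, ∑ z, |ψ z| := by
          rw [prod_univ_sum]
          simp [hG]
        rw [this]
        exact prod_le_one (fun _ _ => sum_nonneg fun _ _ => abs_nonneg _) fun _ _ => hψ

/-- A row on which the readings are at pairwise different addresses contributes a factor `1` to the
trivial bound, and any other row a factor of at most `2 ^ (#U - 1)`, since at least one cell of it
is read. -/
lemma abs_expect_prod_readTable_le {m : ℕ} {L U : Type*} [Fintype L] [DecidableEq L] [Fintype U]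
    [Nonempty U] [DecidableEq U] (ψ : (Fin m → ℤˣ) → ℝ) (hψ : ∑ z, |ψ z| ≤ 1) (a : U → Fin m → L)
    (bad : Fin m → Prop) [DecidablePred bad]
    (hbad : ∀ j, ¬ bad j → Function.Injective fun u => a u j) :
    |𝔼 x : Fin m × L → ℤˣ, ∏ u, (2 ^ m * ψ (readTable x (a u)))| ≤
      ∏ j, if bad j then (2 : ℝ) ^ (Fintype.card U - 1) else 1 := by
  have h := sum_prod_abs_readTable_le ψ hψ a
  have hcard : (Fintype.card (Fin m × L → ℤˣ) : ℝ) = ∏ _j : Fin m, (2 : ℝ) ^ Fintype.card L := by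
    simp [pow_mul, pow_right_comm]
  have hpow : ((2 : ℝ) ^ m) ^ Fintype.card U = ∏ _j : Fin m, (2 : ℝ) ^ Fintype.card U := by
    simp [pow_right_comm]
  have habs : ∀ x : Fin m × L → ℤˣ, |∏ u, (2 ^ m * ψ (readTable x (a u)))| =
      (2 ^ m) ^ Fintype.card U * ∏ u, |ψ (readTable x (a u))| := by
    intro x
    rw [prod_mul_distrib, abs_mul, prod_const, card_univ, abs_of_pos (by positivity), abs_prod]
  refine (abs_expect_le _ _).trans ?_
  rw [Fintype.expect_eq_sum_div_card, sum_congr rfl fun x _ => habs x, ← mul_sum, hcard,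
    div_le_iff₀ (prod_pos fun _ _ => by positivity)]
  refine (mul_le_mul_of_nonneg_left h (by positivity)).trans ?_
  rw [hpow, ← prod_mul_distrib, ← prod_mul_distrib]
  refine prod_le_prod (fun j _ => by positivity) fun j _ => ?_
  rw [mul_div_left_comm, mul_comm]
  refine mul_le_mul_of_nonneg_right ?_ (by positivity)
  split_ifs with hj
  · rw [div_le_iff₀ (by positivity), ← pow_add]
    refine pow_le_pow_right₀ (by norm_num) ?_
    have : 0 < #(univ.image fun u => a u j) := card_pos.2 (univ_nonempty.image _)
    omega
  · rw [card_image_of_injective _ (hbad j hj), card_univ, div_self (by positivity)]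

/-! ### The discrepancy bound -/

lemma expect_apply_coordinate {K : ℕ} {α : Type} [Fintype α] [Nonempty α] (i : Fin K) (f : α → ℝ) :
    𝔼 v : Fin K → α, f (v i) = 𝔼 a, f a := by
  rw [Fintype.expect_equiv (Equiv.funSplitAt i α) (fun v => f (v i)) (fun p => f p.1) fun v => rfl,
    ← univ_product_univ, expect_product]
  simp only [Fintype.expect_const]

lemma expect_coincidence_le {K ℓ : ℕ} [NeZero ℓ] {t : ℝ} (ht : 0 ≤ t) :
    𝔼 v : Fin K → Fin ℓ × Fin ℓ, (if ∃ i, (v i).1 = (v i).2 then t else 1) ≤ 1 + t * K / ℓ := by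
  have hone : 𝔼 p : Fin ℓ × Fin ℓ, (if p.1 = p.2 then (1 : ℝ) else 0) = 1 / ℓ := by
    rw [← univ_product_univ, expect_product]
    have : ∀ a : Fin ℓ, 𝔼 b : Fin ℓ, (if a = b then (1 : ℝ) else 0) = 1 / ℓ := by
      intro a
      rw [Fintype.expect_eq_sum_div_card]
      simp
    simp only [this, Fintype.expect_const]
  calc 𝔼 v : Fin K → Fin ℓ × Fin ℓ, (if ∃ i, (v i).1 = (v i).2 then t else 1)
      ≤ 𝔼 v : Fin K → Fin ℓ × Fin ℓ, (1 + t * ∑ i, if (v i).1 = (v i).2 then (1 : ℝ) else 0) := by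
        refine expect_le_expect fun v _ => ?_
        have hnn : ∀ i ∈ (univ : Finset (Fin K)), (0 : ℝ) ≤ if (v i).1 = (v i).2 then 1 else 0 :=
          fun i _ => by split_ifs <;> norm_num
        split_ifs with h
        · obtain ⟨i, hi⟩ := h
          have := single_le_sum hnn (mem_univ i)
          rw [if_pos hi] at this
          nlinarith
        · have := sum_nonneg hnn
          nlinarith
    _ = 1 + t * K / ℓ := by
        rw [expect_add_distrib, Fintype.expect_const, ← mul_expect, expect_sum_comm]
        have : ∀ i : Fin K, 𝔼 v : Fin K → Fin ℓ × Fin ℓ, (if (v i).1 = (v i).2 then (1 : ℝ) else 0)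
            = 1 / ℓ := fun i => by
          rw [expect_apply_coordinate i fun p : Fin ℓ × Fin ℓ => if p.1 = p.2 then (1 : ℝ) else 0,
            hone]
        simp only [this, sum_const, card_univ, Fintype.card_fin, nsmul_eq_mul]
        ring

/-- Exchanges the order of the indices `i` and `j` in a pair of families. -/
def pairFlip (K m : ℕ) (α : Type) :
    (Fin K → (Fin m → α) × (Fin m → α)) ≃ (Fin m → Fin K → α × α) where
  toFun w j i := ((w i).1 j, (w i).2 j)
  invFun v i := (fun j => (v j i).1, fun j => (v j i).2)
  left_inv _ := rfl
  right_inv _ := rfl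

/-- The exponential moment of the number of rows on which two random tuples of addresses
coincide in some component. -/
lemma expect_prod_coincidence_le {K m ℓ : ℕ} [NeZero ℓ] {t : ℝ} (ht : 0 ≤ t) :
    𝔼 w : Fin K → (Fin m → Fin ℓ) × (Fin m → Fin ℓ),
      ∏ j, (if ∃ i, (w i).1 j = (w i).2 j then t else 1) ≤ (1 + t * K / ℓ) ^ m := by
  rw [Fintype.expect_equiv (pairFlip K m (Fin ℓ))
    (fun w => ∏ j, (if ∃ i, (w i).1 j = (w i).2 j then t else 1))
    (fun v => ∏ j, (if ∃ i, (v j i).1 = (v j i).2 then t else 1)) fun w => rfl]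
  have := expect_pow (univ : Finset (Fin K → Fin ℓ × Fin ℓ))
    (fun v => if ∃ i, (v i).1 = (v i).2 then t else 1) m
  rw [Fintype.piFinset_univ] at this
  rw [← this]
  exact pow_le_pow_left₀ (expect_nonneg fun v _ => by split_ifs <;> linarith)
    (expect_coincidence_le ht) m

/-- The discrepancy bound: a function orthogonal to all functions of at most `N` coordinates,
applied to the cells of a random table that are selected by random addresses, has exponentially
small correlation with every cylinder intersection. -/
lemma expect_readTable_pow_le {K m ℓ N : ℕ} [NeZero ℓ] (ψ : (Fin m → ℤˣ) → ℝ)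
    (hψ : ∑ z, |ψ z| ≤ 1)
    (horth : ∀ B : Finset (Fin m), #B ≤ N → ∀ h : (Fin m → ℤˣ) → ℝ,
        (∀ z z', (∀ j ∈ B, z j = z' j) → h z = h z') → ∑ z, ψ z * h z = 0)
    (χ₀ : (Fin K → Fin m → Fin ℓ) → ℝ) (hχ₀ : ∀ y, |χ₀ y| ≤ 1)
    (χ : Fin K → (Fin m × (Fin K → Fin ℓ) → ℤˣ) → (Fin K → Fin m → Fin ℓ) → ℝ)
    (hχ : ∀ i x y, |χ i x y| ≤ 1)
    (hχi : ∀ i x y y', (∀ j, j ≠ i → y j = y' j) → χ i x y = χ i x y') :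
    (𝔼 x : Fin m × (Fin K → Fin ℓ) → ℤˣ, 𝔼 y : Fin K → Fin m → Fin ℓ,
      2 ^ m * ψ (readTable x fun j i => y i j) * (χ₀ y * ∏ i, χ i x y)) ^ 2 ^ K ≤
      (1 / 8) ^ (N + 1) * (1 + 8 * 2 ^ (2 ^ K - 1) * K / ℓ) ^ m := by
  have hbox := expect_mul_prod_pow_le_box (Y := Fin m → Fin ℓ)
    (fun (x : Fin m × (Fin K → Fin ℓ) → ℤˣ) y => 2 ^ m * ψ (readTable x fun j i => y i j) * χ₀ y)
    χ hχ hχi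
  simp only [mul_assoc] at hbox ⊢
  refine hbox.trans ?_
  rw [expect_comm]
  calc 𝔼 w : Fin K → (Fin m → Fin ℓ) × (Fin m → Fin ℓ), 𝔼 x : Fin m × (Fin K → Fin ℓ) → ℤˣ,
        ∏ u, 2 ^ m * (ψ (readTable x fun j i => boxVertex u w i j) * χ₀ (boxVertex u w))
      ≤ 𝔼 w : Fin K → (Fin m → Fin ℓ) × (Fin m → Fin ℓ), (1 / 8) ^ (N + 1) *
          ∏ j, (if ∃ i, (w i).1 j = (w i).2 j then 8 * 2 ^ (2 ^ K - 1) else 1) := by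
        refine expect_le_expect fun w _ => ?_
        set a : (Fin K → Bool) → Fin m → Fin K → Fin ℓ := fun u j i => boxVertex u w i j
        set bad : Fin m → Prop := fun j => ∃ i, (w i).1 j = (w i).2 j
        have hgood : ∀ j, ¬ bad j → Function.Injective fun u => a u j := by
          intro j hj u u' huu
          funext i
          have h1 : boxVertex u w i j = boxVertex u' w i j := congrFun huu i
          have h2 : (w i).1 j ≠ (w i).2 j := fun h => hj ⟨i, h⟩
          unfold boxVertex at h1
          cases hu : u i <;> cases hu' : u' i <;> simp [hu, hu'] at h1 ⊢
          · exact h2 h1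
          · exact h2 h1.symm
        have hfac : 𝔼 x : Fin m × (Fin K → Fin ℓ) → ℤˣ,
              ∏ u, 2 ^ m * (ψ (readTable x (a u)) * χ₀ (boxVertex u w))
            = (𝔼 x : Fin m × (Fin K → Fin ℓ) → ℤˣ, ∏ u, (2 ^ m * ψ (readTable x (a u)))) *
              ∏ u, χ₀ (boxVertex u w) := by
          rw [expect_mul]
          refine expect_congr rfl fun x _ => ?_
          rw [← prod_mul_distrib]
          exact prod_congr rfl fun u _ => by ring
        rw [hfac]
        refine (le_abs_self _).trans ?_
        rw [abs_mul, abs_prod]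
        refine (mul_le_of_le_one_right (abs_nonneg _)
          (prod_le_one (fun _ _ => abs_nonneg _) fun u _ => hχ₀ _)).trans ?_
        rcases le_or_gt #(univ.filter bad) N with hle | hgt
        · -- Few coincidences: the correlation vanishes by orthogonality.
          have hz : 𝔼 x : Fin m × (Fin K → Fin ℓ) → ℤˣ,
              ∏ u, (2 ^ m * ψ (readTable x (a u))) = 0 := by
            simp only [prod_mul_distrib]
            rw [← mul_expect, Fintype.expect_eq_sum_div_card,
              sum_prod_readTable_eq_zero ψ (univ.filter bad) (horth _ hle) a (fun _ => false)]
            · simp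
            · intro j hj u hu h
              exact hu (hgood j (by simpa using hj) h)
          rw [hz, abs_zero]
          exact mul_nonneg (by positivity) (prod_nonneg fun j _ => by split_ifs <;> positivity)
        · -- Many coincidences: the trivial bound, weighted by `8` for each coincidence.
          have h := abs_expect_prod_readTable_le ψ hψ a bad hgood
          rw [Fintype.card_fun, Fintype.card_bool, Fintype.card_fin] at h
          refine h.trans ?_
          have hsplit : ∏ j, (if bad j then (8 : ℝ) * 2 ^ (2 ^ K - 1) else 1)
              = 8 ^ #(univ.filter bad) * ∏ j, (if bad j then (2 : ℝ) ^ (2 ^ K - 1) else 1) := by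
            rw [← prod_const, prod_filter, ← prod_mul_distrib]
            exact prod_congr rfl fun j _ => by split_ifs <;> simp
          rw [hsplit, ← mul_assoc]
          refine le_mul_of_one_le_left (prod_nonneg fun j _ => by split_ifs <;> positivity) ?_
          rw [one_div, inv_pow, ← div_eq_inv_mul, one_le_div (by positivity)]
          exact pow_le_pow_right₀ (by norm_num) hgt
    _ ≤ (1 / 8) ^ (N + 1) * (1 + 8 * (2 ^ (2 ^ K - 1) * K) / ℓ) ^ m := by
        rw [← mul_expect, ← mul_assoc 8]
        gcongr
        exact expect_prod_coincidence_le (by positivity)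

/-- The parameters are chosen such that the second factor is at most `exp N`, which is absorbed by
the first one. -/
lemma discrepancy_numerics {K N : ℕ} (hK : 1 ≤ K) (hN : 1 ≤ N) {m ℓ : ℕ} (hm : m = 8 * N ^ 2)
    (hℓ : ℓ = 64 * K * 2 ^ (2 ^ K - 1) * N) :
    (1 / 8 : ℝ) ^ (N + 1) * (1 + 8 * 2 ^ (2 ^ K - 1) * K / ℓ) ^ m ≤ (1 / 2) ^ N := by
  have hN' : (0 : ℝ) < N := by exact_mod_cast hN
  have hK' : (0 : ℝ) < K := by exact_mod_cast hK
  have hx : (8 * 2 ^ (2 ^ K - 1) * K / ℓ : ℝ) = 1 / (8 * N) := by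
    rw [hℓ]
    push_cast
    field_simp
    norm_num
  have hexp : (1 + 1 / (8 * N) : ℝ) ^ m ≤ 4 ^ N := by
    calc (1 + 1 / (8 * N) : ℝ) ^ m ≤ Real.exp (1 / (8 * N)) ^ m := by
          refine pow_le_pow_left₀ (by positivity) ?_ m
          rw [add_comm]
          exact Real.add_one_le_exp _
      _ = Real.exp 1 ^ N := by
          rw [← Real.exp_nat_mul, ← Real.exp_nat_mul, hm]
          congr 1
          push_cast
          field_simp
      _ ≤ 4 ^ N := pow_le_pow_left₀ (Real.exp_pos 1).le (by linarith [Real.exp_one_lt_d9]) N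
  rw [hx]
  calc (1 / 8 : ℝ) ^ (N + 1) * (1 + 1 / (8 * N)) ^ m ≤ (1 / 8) ^ N * 4 ^ N := by
        gcongr ?_ * ?_
        exact pow_le_pow_of_le_one (by norm_num) (by norm_num) (Nat.le_succ N)
    _ = (1 / 2) ^ N := by rw [← mul_pow]; norm_num

/-! ### The lower bound for disjointness -/

/-- The inputs to disjointness which encode a table and addresses: player `0` holds the table, and
player `i + 1` holds the set of the cells that agree with the `i`-th component of the addresses.
The cells are embedded into `Fin n` by `e`, and the remaining coordinates are `1`. -/
noncomputable def tableInput {K m ℓ n : ℕ} (e : Fin m × (Fin K → Fin ℓ) ↪ Fin n)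
    (ω : (Fin m × (Fin K → Fin ℓ) → ℤˣ) × (Fin K → Fin m → Fin ℓ)) (i : Fin (K + 1)) :
    Fin n → ℤˣ :=
  Function.extend e
    (Fin.cases ω.1 (fun i c => if c.2 i = ω.2 i c.1 then -1 else 1) i) 1

/-- All players hold the cell `(j, l)` only if `l` is the address of row `j`, so disjointness of the
inputs computes the negated disjunction of the cells that are read. -/
lemma disjFn_tableInput {K m ℓ n : ℕ} (e : Fin m × (Fin K → Fin ℓ) ↪ Fin n)
    (ω : (Fin m × (Fin K → Fin ℓ) → ℤˣ) × (Fin K → Fin m → Fin ℓ)) :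
    disjFn (K + 1) n (tableInput e ω) = -orFn m (readTable ω.1 fun j i => ω.2 i j) := by
  have hiff : (∃ t, andStrings (K + 1) n (tableInput e ω) t = -1) ↔
      ∃ j, readTable ω.1 (fun j i => ω.2 i j) j = -1 := by
    have hand : ∀ t, andStrings (K + 1) n (tableInput e ω) t = -1 ↔
        ∀ i, tableInput e ω i t = -1 := fun t => by
      unfold andStrings
      split_ifs with h <;> simp [h]
    simp only [hand]
    constructor
    · rintro ⟨t, ht⟩
      by_cases hmem : ∃ c, e c = t
      · obtain ⟨⟨j, l⟩, rfl⟩ := hmem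
        simp only [tableInput, e.injective.extend_apply] at ht
        have hl : l = fun i => ω.2 i j := by
          funext i
          have := ht i.succ
          by_contra hne
          simp [hne] at this
        refine ⟨j, ?_⟩
        have := ht 0
        rw [hl] at this
        simpa [readTable] using this
      · have := ht 0
        rw [tableInput, Function.extend_apply' _ _ _ hmem] at this
        simp at this
    · rintro ⟨j, hj⟩
      refine ⟨e (j, fun i => ω.2 i j), fun i => ?_⟩
      rw [tableInput, e.injective.extend_apply]
      refine Fin.cases ?_ (fun i => ?_) i
      · simpa [readTable] using hj
      · simp
  unfold disjFn orFn
  simp only [hiff]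

/-- Comparison of the correlation of a protocol with a function on the one hand and its error on
the other hand. -/
lemma sum_mul_sub_le_of_error {Ω : Type*} [Fintype Ω] (A : Ω → ℝ) (f g : Ω → ℤˣ) :
    |∑ ω, A ω * ((f ω : ℤ) : ℝ)| - 2 * ∑ ω, |A ω| * (if g ω ≠ f ω then 1 else 0) ≤
      |∑ ω, A ω * ((g ω : ℤ) : ℝ)| := by
  have h : |∑ ω, A ω * ((f ω : ℤ) : ℝ) - ∑ ω, A ω * ((g ω : ℤ) : ℝ)| ≤
      2 * ∑ ω, |A ω| * (if g ω ≠ f ω then 1 else 0) := by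
    rw [← sum_sub_distrib, mul_sum]
    refine (abs_sum_le_sum_abs _ _).trans (sum_le_sum fun ω _ => ?_)
    rw [← mul_sub, abs_mul, mul_left_comm]
    refine mul_le_mul_of_nonneg_left ?_ (abs_nonneg _)
    rcases Int.units_eq_one_or (f ω) with h1 | h1 <;>
      rcases Int.units_eq_one_or (g ω) with h2 | h2 <;> rw [h1, h2] <;> norm_num
  linarith [abs_sub_abs_le_abs_sub (∑ ω, A ω * ((f ω : ℤ) : ℝ)) (∑ ω, A ω * ((g ω : ℤ) : ℝ))]

/-- If the universe accommodates a table with `8 * N ^ 2` rows and sufficiently many addresses, then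
a protocol for disjointness has correlation at least `2 / 3 - 2 * (1 / 4)` with the lift of the dual
witness for `OR`, whereas cheap protocols have tiny correlation with it. -/
lemma le_cost_of_hasRandProtocol {K N n c : ℕ} (hK : 1 ≤ K) (hN : 1 ≤ N)
    (hn : 8 * N ^ 2 * (64 * K * 2 ^ (2 ^ K - 1) * N) ^ K ≤ n)
    (h : HasRandProtocol (X := fun _ : Fin (K + 1) => Fin n → ℤˣ) (1 / 4) (disjFn (K + 1) n) c) :
    N ≤ 2 ^ K * (c + 3) := by
  obtain ⟨m, hm⟩ : ∃ m, m = 8 * N ^ 2 := ⟨_, rfl⟩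
  obtain ⟨ℓ, hℓ⟩ : ∃ ℓ, ℓ = 64 * K * 2 ^ (2 ^ K - 1) * N := ⟨_, rfl⟩
  rw [← hm, ← hℓ] at hn
  have : NeZero ℓ := ⟨by rw [hℓ]; positivity⟩
  obtain ⟨ψ, hψ, hor, horth⟩ := exists_or_dual hN hm.ge
  obtain ⟨e⟩ : Nonempty (Fin m × (Fin K → Fin ℓ) ↪ Fin n) :=
    Function.Embedding.nonempty_of_card_le (by simpa using hn)
  obtain ⟨P, hcost, herr⟩ := h
  set Ω := (Fin m × (Fin K → Fin ℓ) → ℤˣ) × (Fin K → Fin m → Fin ℓ)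
  set q : Ω → Fin m → ℤˣ := fun ω => readTable ω.1 fun j i => ω.2 i j with hq
  set A : Ω → ℝ := fun ω => 2 ^ m * ψ (q ω) / Fintype.card Ω with hA
  have hcard : (0 : ℝ) < Fintype.card Ω := by exact_mod_cast Fintype.card_pos
  have hsumA : ∀ F : Ω → ℝ, ∑ ω, A ω * F ω = 𝔼 x, 𝔼 y, 2 ^ m * ψ (q (x, y)) * F (x, y) := by
    intro F
    rw [← expect_product', univ_product_univ, Fintype.expect_eq_sum_div_card, sum_div]
    exact sum_congr rfl fun ω _ => by rw [hA]; ring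
  -- The cells read are uniformly distributed, also conditionally on the addresses.
  have hunif : ∀ G : (Fin m → ℤˣ) → ℝ, 𝔼 x, 𝔼 y, 2 ^ m * G (q (x, y)) = ∑ z, G z := by
    intro G
    rw [expect_comm]
    simp only [hq, ← mul_expect, expect_readTable, Fintype.expect_const]
    rw [Fintype.expect_eq_sum_div_card]
    simp
    field_simp
  have hA1 : ∑ ω, |A ω| ≤ 1 := by
    have : ∑ ω, |A ω| = 𝔼 x, 𝔼 y, 2 ^ m * |ψ (q (x, y))| := by
      rw [← expect_product', univ_product_univ, Fintype.expect_eq_sum_div_card, sum_div]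
      refine sum_congr rfl fun ω _ => ?_
      rw [hA, abs_div, abs_mul, abs_of_pos hcard, abs_of_pos (by positivity : (0 : ℝ) < 2 ^ m)]
    rw [this, hunif fun z => |ψ z|]
    exact hψ
  have hAf : |∑ ω, A ω * ((disjFn (K + 1) n (tableInput e ω) : ℤ) : ℝ)| = 2 / 3 := by
    rw [hsumA]
    have : ∀ x y, 2 ^ m * ψ (q (x, y)) * ((disjFn (K + 1) n (tableInput e (x, y)) : ℤ) : ℝ)
        = 2 ^ m * -(ψ (q (x, y)) * ((orFn m (q (x, y)) : ℤ) : ℝ)) := by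
      intro x y
      rw [disjFn_tableInput]
      push_cast
      ring
    simp only [this]
    rw [hunif fun z => -(ψ z * ((orFn m z : ℤ) : ℝ)), sum_neg_distrib, hor]
    norm_num
  -- `M` is the root of the discrepancy bound.
  set M : ℝ := ((1 / 2 : ℝ) ^ N) ^ ((2 ^ K : ℕ) : ℝ)⁻¹
  have hM0 : 0 ≤ M := by positivity
  have hMpow : M ^ 2 ^ K = (1 / 2) ^ N := Real.rpow_inv_natCast_pow (by positivity) (by positivity)
  have hcyl : ∀ χ, IsCylinderFamily (tableInput e) χ → |∑ ω, A ω * ∏ i, χ i ω| ≤ M := by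
    intro χ hχ
    have h0 : ∀ x y, χ 0 (x, y) = χ 0 (1, y) := fun x y => hχ.indep 0 _ _ fun j hj => by
      obtain ⟨l, rfl⟩ := Fin.exists_succ_eq.2 hj
      rfl
    have hdisc := expect_readTable_pow_le ψ hψ horth (fun y => χ 0 (1, y))
      (fun y => hχ.abs_le_one 0 _) (fun i x y => χ i.succ (x, y))
      (fun i x y => hχ.abs_le_one i.succ _) (fun i x y y' hy => hχ.indep i.succ _ _ fun j => by
        refine Fin.cases (fun _ => rfl) (fun l hl => ?_) j
        have := hy l fun hli => hl (by rw [hli])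
        simp only [tableInput, Fin.cases_succ, this])
    have heq : ∑ ω, A ω * ∏ i, χ i ω = 𝔼 x, 𝔼 y, 2 ^ m * ψ (q (x, y)) *
        (χ 0 (1, y) * ∏ i : Fin K, χ i.succ (x, y)) := by
      rw [hsumA]
      simp only [Fin.prod_univ_succ, h0]
    rw [← heq] at hdisc
    refine le_of_pow_le_pow_left₀ (n := 2 ^ K) (by positivity) hM0 ?_
    rw [Even.pow_abs (Nat.even_pow.2 ⟨even_two, by omega⟩), hMpow]
    exact hdisc.trans (discrepancy_numerics hK hN hm hℓ)
  obtain ⟨p, hp, hperr⟩ := exists_protocol_average_error_le (tableInput e) (fun ω => |A ω|)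
    (fun ω => abs_nonneg _) (by norm_num : (0 : ℝ) ≤ 1 / 4) (disjFn (K + 1) n) P herr
  have hupper := abs_sum_mul_eval_le (tableInput e) A M hcyl p (fun _ _ => 1)
    ⟨fun _ _ => by simp, fun _ _ _ _ => rfl⟩
  simp only [prod_const_one, mul_one] at hupper
  have hlower := sum_mul_sub_le_of_error A (fun ω => disjFn (K + 1) n (tableInput e ω))
    fun ω => p.eval (tableInput e ω)
  rw [hAf] at hlower
  -- `1 / 6 = 2 / 3 - 2 * (1 / 4)`.
  have h6 : 1 ≤ 6 * (2 ^ c * M) := by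
    have : (2 : ℝ) ^ p.cost * M ≤ 2 ^ c * M := by
      gcongr
      · norm_num
      · exact hcost p hp
    linarith
  have hfin : (2 : ℝ) ^ N ≤ 2 ^ (2 ^ K * (c + 3)) := by
    have h8 : 1 ≤ 2 ^ (c + 3) * M := by
      rw [pow_add]
      have : 0 ≤ 2 ^ c * M := by positivity
      linarith
    have := one_le_pow₀ h8 (n := 2 ^ K)
    rw [mul_pow, hMpow, ← pow_mul, one_div, inv_pow, ← div_eq_mul_inv,
      one_le_div (by positivity)] at this
    rwa [mul_comm (2 ^ K)]
  exact (pow_le_pow_iff_right₀ (by norm_num : (1 : ℝ) < 2)).1 hfin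

/-- Disjointness on a nonempty universe is not constant, so it cannot be computed without
communication. -/
lemma one_le_cost_of_hasRandProtocol {k n c : ℕ} (hn : 1 ≤ n)
    (h : HasRandProtocol (X := fun _ : Fin k => Fin n → ℤˣ) (1 / 4) (disjFn k n) c)
    (hk : 1 ≤ k) : 1 ≤ c := by
  obtain ⟨P, hcost, herr⟩ := h
  by_contra! hc
  set T : Bool → Fin k → Fin n → ℤˣ := fun b _ _ => if b then -1 else 1 with hT
  obtain ⟨p, hp, hperr⟩ := exists_protocol_average_error_le T (fun _ => 1)
    (fun _ => zero_le_one) (by norm_num : (0 : ℝ) ≤ 1 / 4) (disjFn k n) P herr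
  have htrue : disjFn k n (T true) = 1 := by
    have : ∃ _ : Fin n, True := ⟨⟨0, hn⟩, trivial⟩
    simp [disjFn, orFn, andStrings, hT, this]
  have hfalse : disjFn k n (T false) = -1 := by
    have : Nonempty (Fin k) := ⟨⟨0, hk⟩⟩
    simp [disjFn, orFn, andStrings, hT]
  have hp0 : p.cost = 0 := by have := hcost p hp; omega
  cases p with
  | output b =>
    simp only [Fintype.sum_bool, htrue, hfalse, NOFProtocol.eval] at hperr
    rcases Int.units_eq_one_or b with rfl | rfl <;> norm_num at hperr
  | speak i msg next => simp [NOFProtocol.cost] at hp0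

lemma parameter_bound {K : ℕ} (hK : 1 ≤ K) :
    K * 2 ^ (2 ^ K - 1) * 2 ^ K ≤ 2 ^ 2 ^ (K + 1) := by
  obtain ⟨J, rfl⟩ : ∃ J, K = J + 1 := ⟨K - 1, by omega⟩
  have h1 : J + 1 ≤ 2 ^ (J + 1) := Nat.lt_two_pow_self.le
  have h2 : (J + 1) + (J + 1) ≤ 2 ^ (J + 1) := by
    have : J + 1 ≤ 2 ^ J := Nat.lt_two_pow_self
    rw [pow_succ]; omega
  calc (J + 1) * 2 ^ (2 ^ (J + 1) - 1) * 2 ^ (J + 1)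
      ≤ 2 ^ (J + 1) * 2 ^ (2 ^ (J + 1)) * 2 ^ (J + 1) := by
        gcongr
        · norm_num
        · omega
    _ = 2 ^ ((J + 1) + (J + 1) + 2 ^ (J + 1)) := by rw [← pow_add, ← pow_add]; congr 1; ring
    _ ≤ 2 ^ 2 ^ (J + 1 + 1) := by
        refine Nat.pow_le_pow_right (by norm_num) ?_
        rw [pow_succ 2 (J + 1)]
        omega

/-- The bound for a given cost `c`, with `N` chosen as large as the universe permits. When `N` is
too small for the discrepancy bound to say anything, `1 ≤ c` suffices. -/
lemma root_le_cost_of_hasRandProtocol {K n c : ℕ} (hK : 1 ≤ K) (hn : 1 ≤ n)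
    (h : HasRandProtocol (X := fun _ : Fin (K + 1) => Fin n → ℤˣ) (1 / 4) (disjFn (K + 1) n) c) :
    (n : ℝ) ^ (((K + 2 : ℕ) : ℝ)⁻¹) ≤ 320 * 2 ^ 2 ^ (K + 1) * c := by
  have hc := one_le_cost_of_hasRandProtocol hn h (by omega)
  set a : ℝ := (n : ℝ) ^ (((K + 2 : ℕ) : ℝ)⁻¹)
  have ha0 : 0 ≤ a := by positivity
  have hapow : a ^ (K + 2) = n := Real.rpow_inv_natCast_pow (by positivity) (by omega)
  set D : ℕ := 64 * K * 2 ^ (2 ^ K - 1) with hD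
  have hD64 : 64 ≤ D := by
    rw [hD, mul_assoc]
    exact Nat.le_mul_of_pos_right 64 (by positivity)
  have hD0 : (0 : ℝ) < D := by exact_mod_cast (by omega : 0 < D)
  -- The largest `N` with `(D * N) ^ (K + 2) ≤ n`, which is slightly more than needed.
  set N : ℕ := ⌊a / D⌋₊ with hN
  have hNc : N ≤ 2 ^ K * (c + 3) := by
    rcases Nat.eq_zero_or_pos N with h0 | hpos
    · rw [h0]; exact Nat.zero_le _
    · refine le_cost_of_hasRandProtocol hK hpos ?_ h
      have h1 : ((D * N : ℕ) : ℝ) ≤ a := by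
        have := Nat.floor_le (div_nonneg ha0 hD0.le)
        rw [← hN, le_div_iff₀ hD0] at this
        push_cast
        linarith
      have h2 : (D * N) ^ (K + 2) ≤ n := by
        have := pow_le_pow_left₀ (Nat.cast_nonneg _) h1 (K + 2)
        rw [hapow] at this
        exact_mod_cast this
      calc 8 * N ^ 2 * (D * N) ^ K ≤ (D * N) ^ 2 * (D * N) ^ K := by
            gcongr
            rw [mul_pow]
            gcongr
            nlinarith
        _ = (D * N) ^ (K + 2) := by ring
        _ ≤ n := h2
  have h3 : a < D * (N + 1) := by
    have := Nat.lt_floor_add_one (a / D)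
    rw [← hN, div_lt_iff₀ hD0] at this
    linarith
  have h4 : D * (N + 1) ≤ 320 * 2 ^ 2 ^ (K + 1) * c := by
    calc D * (N + 1) ≤ D * (5 * 2 ^ K * c) := by
          gcongr
          have : 1 ≤ 2 ^ K := Nat.one_le_two_pow
          nlinarith
      _ = 320 * (K * 2 ^ (2 ^ K - 1) * 2 ^ K) * c := by rw [hD]; ring
      _ ≤ 320 * 2 ^ 2 ^ (K + 1) * c := by
          gcongr
          exact parameter_bound hK
  exact h3.le.trans (by exact_mod_cast h4)

end DisjLowerBound

theorem mainTheorem1 :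
    ∃ c : ℝ, 0 < c ∧ ∀ k n : ℕ, 2 ≤ k →
      c * ((n : ℝ) ^ (1 / ((k : ℝ) + 1)) / (2 : ℝ) ^ (2 ^ k)) ≤
        (randCC (X := fun _ : Fin k => Fin n → ℤˣ) (1 / 4) (disjFn k n) : ℝ) := by
  refine ⟨1 / 320, by norm_num, fun k n hk => ?_⟩
  obtain ⟨K, rfl⟩ : ∃ K, k = K + 1 := ⟨k - 1, by omega⟩
  have hexp : 1 / (((K + 1 : ℕ) : ℝ) + 1) = ((K + 2 : ℕ) : ℝ)⁻¹ := by
    rw [one_div]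
    push_cast
    ring_nf
  rw [hexp]
  rcases Nat.eq_zero_or_pos n with rfl | hn
  · rw [Nat.cast_zero, Real.zero_rpow (by positivity)]
    simp
  · have h : HasRandProtocol (X := fun _ : Fin (K + 1) => Fin n → ℤˣ) (1 / 4) (disjFn (K + 1) n)
        (randCC (X := fun _ : Fin (K + 1) => Fin n → ℤˣ) (1 / 4) (disjFn (K + 1) n)) :=
      Nat.sInf_mem (exists_hasRandProtocol (X := fun _ : Fin (K + 1) => Fin n → ℤˣ) hk
        (1 / 4) (disjFn (K + 1) n))
    have := DisjLowerBound.root_le_cost_of_hasRandProtocol (by omega) hn h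
    rw [mul_div_assoc', div_le_iff₀ (by positivity)]
    linarith
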